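/- Let $k$ be a field of prime characteristic $p$, and let $R=\bigoplus_{n\ge 0}R_n$ be a finitely generated, positively graded commutative $k$-algebra, i.e. $R$ is finitely generated as a $k$-algebra, $\mathbb N$-graded, and $R_0=k$ (the algebra generators may have arbitrary positive degrees). Let $d=\dim R$ be the Krull dimension of $R$ and let $I\subseteq R$ be a homogeneous ideal of height $d-1$. For an ideal $J\subseteq R$ and $q=p^e$ with $e\ge 0$, let $J^{[q]}$ denote the $q$-th Frobenius power of $J$, the ideal generated by the $q$-th powers of the elements (equivalently, of any set of generators) of $J$. Then the Frobenius powers of $I$ have linear growth of primary decompositions: there is a natural number $c$ such that for every $q=p^e$, $e\ge 0$, there are an integer $r$ and primary ideals $Q_1,\dots,Q_r$ of $R$ (all depending on $q$) with $$I^{[q]}=Q_1\cap Q_2\cap\cdots\cap Q_r\qquad\text{and}\qquad \bigl((\sqrt{Q_i})^{c}\bigr)^{[q]}\subseteq Q_i\quad\text{for all } i=1,\dots,r.$$ -/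

import Mathlib

/-!
Let `I = (f₁, …, fₙ)` with `fᵢ` homogeneous of positive degree, let `q = p ^ e` and
`J = (f₁ ^ q, …, fₙ ^ q)`, and let `M` be the irrelevant ideal. The height hypothesis gives
`dim R / I ≤ 1`. Since associated primes of `J` are homogeneous, each of them is minimal over `I` or
equal to `M`.

If `P` is minimal over `I`, then in the local ring at `P` some power `P ^ c` lies in `I`, hence
`P ^ (c * (n + 1) * q)` lies in `I ^ (n * q + 1) ⊆ J`; a `P`-primary ideal containing `J` is
contracted from that local ring.

The `M`-primary component may be replaced by `J + M ^ (c * q)` as soon as the `M`-torsion of `R / J`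
vanishes in degrees `≥ c * q`. To get this with `c` independent of `q`, take a homogeneous
parameter `y` modulo `I` of degree at least every `deg fᵢ`. Then `R` is finite over
`k[T₁, …, Tₙ][X]` through `Tᵢ ↦ fᵢ`, `X ↦ y`, and `X` is a nonzerodivisor modulo `(Tᵢ ^ q)`. One
application of Artin–Rees to a presentation of the module `R`, which does not involve `q`, bounds
the `y`-torsion for all `q` at once.
-/

/-- The bracket power `I^{[n]}`: the ideal generated by the `n`-th powers of the elements of `I`.
For `n = p ^ e` in characteristic `p` this is the Frobenius power, and the `n`-th powers of any
set of generators of `I` generate it, see `frobeniusPower_span`. -/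
def frobeniusPower {R : Type*} [CommRing R] (I : Ideal R) (n : ℕ) : Ideal R :=
  Ideal.span ((fun x : R => x ^ n) '' (I : Set R))

theorem frobeniusPower_span {R : Type*} [CommRing R] (p : ℕ) [Fact p.Prime] [CharP R p]
    (e : ℕ) (S : Set R) :
    frobeniusPower (Ideal.span S) (p ^ e) = Ideal.span ((fun x : R => x ^ p ^ e) '' S) := by
  have h : ∀ J : Ideal R, frobeniusPower J (p ^ e) = J.map (iterateFrobenius R p e) :=
    fun _ => rfl
  rw [h, Ideal.map_span]
  rfl

/-- The Frobenius powers of `I` have linear growth of primary decompositions: there is a `c`,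
independent of `q = p ^ e`, such that every `I^{[q]}` has a primary decomposition
`Q₁ ∩ ⋯ ∩ Qᵣ` with `(√Qᵢ)^{c[q]} = ((√Qᵢ)^c)^{[q]} ⊆ Qᵢ` for all `i`. -/
def HasLinearGrowthOfPrimaryDecompositions {R : Type*} [CommRing R] (p : ℕ) (I : Ideal R) :
    Prop :=
  ∃ c : ℕ, ∀ e : ℕ, ∃ (r : ℕ) (Q : Fin r → Ideal R),
    (∀ i, (Q i).IsPrimary) ∧
    frobeniusPower I (p ^ e) = ⨅ i, Q i ∧
    ∀ i, frobeniusPower ((Q i).radical ^ c) (p ^ e) ≤ Q i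

section PolynomialCancellation

open Polynomial

theorem mem_smul_top_pi_iff {A ι : Type*} [CommRing A] [Finite ι] (I : Ideal A) (a : ι → A) :
    a ∈ I • (⊤ : Submodule A (ι → A)) ↔ ∀ i, a i ∈ I := by
  classical
  cases nonempty_fintype ι
  refine ⟨fun h i => ?_, fun h => ?_⟩
  · have hi := Submodule.mem_map_of_mem (f := LinearMap.proj (R := A) (φ := fun _ : ι => A) i) h
    rw [Submodule.map_smul''] at hi
    simpa using Submodule.smul_mono le_rfl le_top hi
  · rw [pi_eq_sum_univ' a]
    exact Submodule.sum_mem _ fun i _ => Submodule.smul_mem_smul (h i) Submodule.mem_top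

variable {B : Type*} [CommRing B]

theorem mem_map_C_smul_top_of_X_pow_smul_mem {ι : Type*} [Finite ι] {J : Ideal B} {N : ℕ}
    {a : ι → B[X]} (h : (X ^ N : B[X]) • a ∈ J.map C • (⊤ : Submodule B[X] (ι → B[X]))) :
    a ∈ J.map C • (⊤ : Submodule B[X] (ι → B[X])) := by
  rw [mem_smul_top_pi_iff] at *
  intro i
  rw [Ideal.mem_map_C_iff]
  intro n
  have hcoeff := Ideal.mem_map_C_iff.1 (h i) (n + N)
  rwa [Pi.smul_apply, smul_eq_mul, coeff_X_pow_mul] at hcoeff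

theorem exists_sub_mem_map_C_smul_top_of_X_pow_smul_sub_mem {ι : Type*} [Finite ι] {J : Ideal B}
    {N : ℕ} {K : Submodule B[X] (ι → B[X])} {a v : ι → B[X]}
    (hv : v ∈ J.map C • (⊤ : Submodule B[X] (ι → B[X])))
    (h : (X ^ N : B[X]) • a - v ∈ (J.map C ⊔ Ideal.span {X ^ N}) • K) :
    ∃ b ∈ K, a - b ∈ J.map C • (⊤ : Submodule B[X] (ι → B[X])) := by
  rw [Submodule.sup_smul, Submodule.ideal_span_singleton_smul] at h
  obtain ⟨u, hu, z, hz, huz⟩ := Submodule.mem_sup.1 h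
  obtain ⟨b, hb, rfl⟩ := (Submodule.mem_smul_pointwise_iff_exists _ _ _).1 hz
  refine ⟨b, hb, mem_map_C_smul_top_of_X_pow_smul_mem (N := N) ?_⟩
  have hab : (X ^ N : B[X]) • (a - b) = u + v := by
    rw [smul_sub, sub_eq_iff_eq_add, add_right_comm, huz, sub_add_cancel]
  rw [hab]
  exact add_mem (Submodule.smul_mono le_rfl le_top hu) hv

theorem map_C_sup_span_X_pow_add_le {𝔤 J : Ideal B} {t : ℕ} (hJ : 𝔤 ^ t ≤ J) (N : ℕ) :
    (𝔤.map C ⊔ Ideal.span {X}) ^ (t + N) ≤ J.map C ⊔ Ideal.span {X ^ N} := by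
  refine Ideal.sup_pow_add_le_pow_sup_pow.trans (sup_le_sup ?_ ?_)
  · rw [← Ideal.map_pow]
    exact Ideal.map_mono hJ
  · rw [Ideal.span_singleton_pow]

-- Lift to the free module, where `X` is a nonzerodivisor modulo `J.map C`. The error term lies in
-- `ker π` and deep in the `𝔫`-adic filtration, so Artin–Rees puts it in `𝔫 ^ (t + N) • ker π`,
-- where it can be absorbed.
theorem exists_forall_mem_map_C_smul_top_of_X_pow_smul_mem [IsNoetherianRing B] {M : Type*}
    [AddCommGroup M] [Module B[X] M] [Module.Finite B[X] M] {𝔤 : Ideal B} {𝔫 : Ideal B[X]}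
    (h𝔫 : 𝔫 = 𝔤.map C ⊔ Ideal.span {X}) :
    ∃ k₀ : ℕ, ∀ (J : Ideal B) (q t N : ℕ), J ≤ 𝔤 ^ q → 𝔤 ^ t ≤ J →
      ∀ x ∈ 𝔫 ^ (k₀ + t + q) • (⊤ : Submodule B[X] M),
      (X ^ N : B[X]) • x ∈ J.map C • 𝔫 ^ (k₀ + t + N) • (⊤ : Submodule B[X] M) →
      x ∈ J.map C • (⊤ : Submodule B[X] M) := by
  obtain ⟨s, π, hπ⟩ := Module.Finite.exists_fin' B[X] M
  obtain ⟨k₀, hk₀⟩ := Ideal.exists_pow_inf_eq_pow_smul 𝔫 (LinearMap.ker π)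
  refine ⟨k₀, fun J q t N hJq htJ x hx hNx => ?_⟩
  have hmap (I : Ideal B[X]) : I • (⊤ : Submodule B[X] M) = (I • ⊤ : Submodule B[X] _).map π := by
    rw [Submodule.map_smul'', Submodule.map_top, LinearMap.range_eq_top.2 hπ]
  rw [hmap] at hx
  obtain ⟨a, ha, rfl⟩ := hx
  rw [hmap, ← Submodule.map_smul''] at hNx
  obtain ⟨v, hv, hva⟩ := hNx
  have hJ𝔫 : J.map C ≤ 𝔫 ^ q := by
    refine (Ideal.map_mono hJq).trans ?_
    rw [Ideal.map_pow, h𝔫]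
    exact Ideal.pow_right_mono le_sup_left q
  have hX𝔫 : X ^ N ∈ 𝔫 ^ N :=
    Ideal.pow_mem_pow (h𝔫 ▸ Ideal.mem_sup_right (Ideal.mem_span_singleton_self X)) N
  have hdeep : (X ^ N : B[X]) • a - v ∈ 𝔫 ^ (k₀ + (t + N + q)) • (⊤ : Submodule B[X] _) := by
    refine sub_mem ?_ ?_
    · rw [show k₀ + (t + N + q) = N + (k₀ + t + q) by ring, pow_add, Submodule.mul_smul]
      exact Submodule.smul_mem_smul hX𝔫 ha
    · rw [show k₀ + (t + N + q) = q + (k₀ + t + N) by ring, pow_add, Submodule.mul_smul]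
      exact Submodule.smul_mono_left hJ𝔫 hv
  have hker : (X ^ N : B[X]) • a - v ∈ 𝔫 ^ (t + N) • LinearMap.ker π := by
    have hinf : (X ^ N : B[X]) • a - v ∈ 𝔫 ^ (k₀ + (t + N + q)) • ⊤ ⊓ LinearMap.ker π :=
      ⟨hdeep, by simp [hva]⟩
    rw [hk₀ _ (Nat.le_add_right _ _), Nat.add_sub_cancel_left] at hinf
    exact Submodule.smul_mono (Ideal.pow_le_pow_right (Nat.le_add_right _ _)) inf_le_right hinf
  obtain ⟨b, hb, hab⟩ := exists_sub_mem_map_C_smul_top_of_X_pow_smul_sub_mem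
    (Submodule.smul_mono le_rfl le_top hv)
    (Submodule.smul_mono_left (h𝔫 ▸ map_C_sup_span_X_pow_add_le htJ N) hker)
  have hπab := Submodule.mem_map_of_mem (f := π) hab
  rwa [← hmap, map_sub, LinearMap.mem_ker.1 hb, sub_zero] at hπab

theorem exists_forall_mem_map_of_X_pow_mul_mem [IsNoetherianRing B] {R : Type*} [CommRing R]
    {φ : B[X] →+* R} (hφ : φ.Finite) {𝔤 : Ideal B} {𝔫 : Ideal R}
    (h𝔫 : 𝔫 = 𝔤.map (φ.comp C) ⊔ Ideal.span {φ X}) :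
    ∃ k₀ : ℕ, ∀ (J : Ideal B) (q t N : ℕ), J ≤ 𝔤 ^ q → 𝔤 ^ t ≤ J →
      ∀ x ∈ 𝔫 ^ (k₀ + t + q),
      φ X ^ N * x ∈ J.map (φ.comp C) * 𝔫 ^ (k₀ + t + N) → x ∈ J.map (φ.comp C) := by
  algebraize [φ]
  obtain ⟨k₀, hk₀⟩ := exists_forall_mem_map_C_smul_top_of_X_pow_smul_mem (M := R) (𝔤 := 𝔤) rfl
  refine ⟨k₀, fun J q t N hJq htJ x hx hNx => ?_⟩
  have h𝔫' : (𝔤.map C ⊔ Ideal.span {X}).map (algebraMap B[X] R) = 𝔫 := by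
    rw [h𝔫, Ideal.map_sup, Ideal.map_map, Ideal.map_span, Set.image_singleton]
    rfl
  have h := hk₀ J q t N hJq htJ x
  rw [← Submodule.mul_smul] at h
  simp only [Ideal.smul_top_eq_map, Submodule.restrictScalars_mem, Ideal.map_pow, Ideal.map_mul,
    Algebra.smul_def, map_pow, h𝔫', Ideal.map_map] at h
  exact h hx hNx

end PolynomialCancellation

section HomogeneousPrimes

open DirectSum

section SupportMod

variable {ι σ A : Type*} [CommRing A] [DecidableEq ι] [AddMonoid ι] [SetLike σ A]
  [AddSubmonoidClass σ A]

open Classical in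
/-- The support of `x` modulo `I`: the set of degrees in which the component of `x` is not in
`I`. Its cardinality is the induction measure in the proof that associated primes of homogeneous
ideals are homogeneous. -/
noncomputable def supportMod (𝒜 : ι → σ) [GradedRing 𝒜] (I : Ideal A) (x : A) : Finset ι :=
  {i ∈ (decompose 𝒜 x).support | (decompose 𝒜 x i : A) ∉ I}

variable {𝒜 : ι → σ} [GradedRing 𝒜] {I : Ideal A} {x : A}

theorem mem_supportMod {i : ι} : i ∈ supportMod 𝒜 I x ↔ (decompose 𝒜 x i : A) ∉ I := by
  simp only [supportMod, Finset.mem_filter, DFinsupp.mem_support_iff, and_iff_right_iff_imp]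
  intro hi h0
  exact hi (by simp [h0])

theorem mem_of_supportMod_eq_empty (h : supportMod 𝒜 I x = ∅) : x ∈ I := by
  classical
  rw [← sum_support_decompose 𝒜 x]
  refine sum_mem fun i _ => ?_
  simpa [h] using (mem_supportMod (𝒜 := 𝒜) (I := I) (x := x) (i := i)).not.1

theorem card_supportMod_homogeneous_mul_lt {s : A} {l m : ι} (hs : s ∈ 𝒜 l)
    (hm : m ∈ supportMod 𝒜 I x) (hsm : s * decompose 𝒜 x m ∈ I) :
    (supportMod 𝒜 I (s * x)).card < (supportMod 𝒜 I x).card := by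
  classical
  have hsub : supportMod 𝒜 I (s * x) ⊆ ((supportMod 𝒜 I x).erase m).image (l + ·) := by
    intro i hi
    rw [mem_supportMod, decompose_mul, coe_mul_apply] at hi
    obtain ⟨⟨a, b⟩, hab, habI⟩ : ∃ ab ∈ _, _ ∉ I := by
      by_contra! h
      exact hi (sum_mem h)
    obtain rfl : l = a := by
      by_contra hla
      exact habI (by simp [decompose_of_mem_ne 𝒜 hs hla])
    rw [decompose_of_mem_same 𝒜 hs] at habI
    refine Finset.mem_image.2 ⟨b, Finset.mem_erase.2 ⟨?_, ?_⟩, (Finset.mem_filter.1 hab).2⟩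
    · rintro rfl
      exact habI hsm
    · exact mem_supportMod.2 fun h => habI (I.mul_mem_left s h)
  calc (supportMod 𝒜 I (s * x)).card ≤ ((supportMod 𝒜 I x).erase m).card :=
        (Finset.card_le_card hsub).trans Finset.card_image_le
    _ < (supportMod 𝒜 I x).card := Finset.card_erase_lt_of_mem hm

end SupportMod

variable {ι σ A : Type*} [CommRing A] [AddCancelCommMonoid ι] [LinearOrder ι]
  [IsOrderedCancelAddMonoid ι] [SetLike σ A] [AddSubmonoidClass σ A] {𝒜 : ι → σ} [GradedRing 𝒜]

theorem isHomogeneous_of_mem_minimalPrimes {I P : Ideal A} (hI : I.IsHomogeneous 𝒜)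
    (hP : P ∈ I.minimalPrimes) : P.IsHomogeneous 𝒜 := by
  have hcore : P ≤ (P.homogeneousCore 𝒜).toIdeal := by
    refine hP.2 ⟨hP.1.1.homogeneousCore, ?_⟩ (Ideal.toIdeal_homogeneousCore_le 𝒜 P)
    rw [← hI.toIdeal_homogeneousCore_eq_self]
    exact Ideal.homogeneousCore_mono 𝒜 hP.1.2
  rw [Ideal.IsHomogeneous.iff_eq]
  exact (Ideal.toIdeal_homogeneousCore_le 𝒜 P).antisymm hcore

theorem leading_mul_leading_mem {T P : Ideal A} (hT : T.IsHomogeneous 𝒜)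
    {s x : A} {l m : ι} (hPx : ∀ a ∈ P, a * x ∈ T) (hs : s ∈ P)
    (hl : l ∈ upperBounds (supportMod 𝒜 P s : Set ι))
    (hm : m ∈ upperBounds (supportMod 𝒜 T x : Set ι)) :
    (decompose 𝒜 s l : A) * decompose 𝒜 x m ∈ T := by
  classical
  have hsx := hT (l + m) (hPx s hs)
  rw [decompose_mul, coe_mul_apply] at hsx
  by_contra hlm
  have hmem : (l, m) ∈ ((decompose 𝒜 s).support ×ˢ (decompose 𝒜 x).support).filter
      (fun ij => ij.1 + ij.2 = l + m) := by
    simp only [Finset.mem_filter, Finset.mem_product, DFinsupp.mem_support_iff]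
    exact ⟨⟨fun h => hlm (by simp [h]), fun h => hlm (by simp [h])⟩, trivial⟩
  rw [← Finset.add_sum_erase _ _ hmem, T.add_mem_iff_left] at hsx
  · exact hlm hsx
  refine sum_mem fun ij hij => ?_
  obtain ⟨i, j⟩ := ij
  simp only [Finset.mem_erase, Finset.mem_filter, ne_eq, Prod.mk.injEq] at hij
  rcases lt_or_ge l i with hi | hi
  · have hsi : (decompose 𝒜 s i : A) ∈ P := by
      by_contra h
      exact (hl (Finset.mem_coe.2 (mem_supportMod.2 h))).not_gt hi
    have hsij := hT (i + j) (hPx _ hsi)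
    rwa [coe_decompose_mul_add_of_left_mem 𝒜 (SetLike.coe_mem _)] at hsij
  · refine T.mul_mem_left _ ?_
    by_contra h
    have hj := hm (Finset.mem_coe.2 (mem_supportMod.2 h))
    obtain rfl : i = l := by
      by_contra hne
      exact (add_lt_add_of_lt_of_le (hi.lt_of_ne hne) hj).ne hij.2.2
    exact hij.1 ⟨rfl, add_left_cancel hij.2.2⟩

theorem isHomogeneous_of_mem_iff_mul_mem {T P : Ideal A} (hT : T.IsHomogeneous 𝒜)
    (hP : P.IsPrime) {x : A} (hPx : ∀ s, s ∈ P ↔ s * x ∈ T) : P.IsHomogeneous 𝒜 := by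
  induction hn : (supportMod 𝒜 T x).card using Nat.strong_induction_on generalizing x with
  | _ n ih =>
  by_contra hPh
  obtain ⟨s, hs, hsP⟩ : ∃ s ∈ P, (supportMod 𝒜 P s).Nonempty := by
    by_contra! h
    refine hPh fun i s hs => ?_
    by_contra hi
    have hmem := mem_supportMod.2 hi
    rw [h s hs] at hmem
    exact Finset.notMem_empty i hmem
  have hxT : (supportMod 𝒜 T x).Nonempty := by
    rw [Finset.nonempty_iff_ne_empty]
    intro h
    refine hP.ne_top ((Ideal.eq_top_iff_one P).2 ((hPx 1).2 ?_))
    rw [one_mul]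
    exact mem_of_supportMod_eq_empty h
  set l := (supportMod 𝒜 P s).max' hsP
  set m := (supportMod 𝒜 T x).max' hxT
  have hsl : (decompose 𝒜 s l : A) ∉ P := mem_supportMod.1 (Finset.max'_mem _ _)
  have hlm : (decompose 𝒜 s l : A) * decompose 𝒜 x m ∈ T :=
    leading_mul_leading_mem hT (fun a => (hPx a).1) hs
      (fun i hi => Finset.le_max' _ _ hi) (fun i hi => Finset.le_max' _ _ hi)
  -- Replacing `x` by `sₗ x` does not change the colon ideal `P`, since `sₗ ∉ P`.
  refine hPh (ih _ (hn ▸ card_supportMod_homogeneous_mul_lt (SetLike.coe_mem _)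
    (Finset.max'_mem _ _) hlm) (fun a => ?_) rfl)
  rw [← mul_assoc, ← hPx, hP.mul_mem_iff_mem_or_mem, or_iff_left hsl]

theorem isHomogeneous_of_mem_associatedPrimes [IsNoetherianRing A] {T P : Ideal A}
    (hT : T.IsHomogeneous 𝒜) (hP : P ∈ T.associatedPrimes) : P.IsHomogeneous 𝒜 := by
  obtain ⟨hprime, x, rfl⟩ := Submodule.isAssociatedPrime_iff.1 hP
  exact isHomogeneous_of_mem_iff_mul_mem (x := x) hT hprime fun s => by
    simp [Submodule.mem_colon_singleton]

end HomogeneousPrimes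

section NatGraded

open DirectSum HomogeneousIdeal

variable {σ A : Type*} [CommRing A] [SetLike σ A] [AddSubmonoidClass σ A] {𝒜 : ℕ → σ}
  [GradedRing 𝒜]

theorem exists_homogeneous_mem_notMem_of_not_le {J P : Ideal A} (hJ : J.IsHomogeneous 𝒜)
    (h : ¬ J ≤ P) : ∃ i, ∃ x ∈ 𝒜 i, x ∈ J ∧ x ∉ P := by
  classical
  obtain ⟨x, hxJ, hxP⟩ := SetLike.not_le_iff_exists.1 h
  by_contra! hcon
  rw [← sum_support_decompose 𝒜 x] at hxP
  exact hxP (sum_mem fun i _ => hcon i _ (SetLike.coe_mem _) (hJ i hxJ))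

theorem exists_homogeneous_pos_mem_forall_mem_notMem {P : Ideal A} [P.IsPrime]
    (hP : ¬ 𝒜₊.toIdeal ≤ P) {S : Finset (Ideal A)} (hhom : ∀ Q ∈ S, Q.IsHomogeneous 𝒜)
    (hS : ∀ Q ∈ S, ¬ Q ≤ P) : ∃ i, 0 < i ∧ ∃ x ∈ 𝒜 i, (∀ Q ∈ S, x ∈ Q) ∧ x ∉ P := by
  have hJ : (𝒜₊.toIdeal ⊓ S.inf id).IsHomogeneous 𝒜 := by
    rw [Finset.inf_eq_iInf]
    exact 𝒜₊.isHomogeneous.inf (.iInf₂ hhom)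
  obtain ⟨i, x, hx, hxJ, hxP⟩ := exists_homogeneous_mem_notMem_of_not_le (P := P) hJ fun hle => by
    rw [Ideal.IsPrime.inf_le ‹_›, Ideal.IsPrime.inf_le' ‹_›] at hle
    obtain h | ⟨Q, hQ, h⟩ := hle
    exacts [hP h, hS Q hQ h]
  refine ⟨i, Nat.pos_of_ne_zero ?_, x, hx, fun Q hQ => Finset.inf_le (f := id) hQ hxJ.2, hxP⟩
  rintro rfl
  have hx0 : x = 0 := (decompose_of_mem_same 𝒜 hx).symm.trans hxJ.1
  exact hxP (hx0 ▸ P.zero_mem)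

theorem exists_homogeneous_pos_forall_notMem {S : Finset (Ideal A)}
    (hS : IsAntichain (· ≤ ·) (S : Set (Ideal A))) (hprime : ∀ P ∈ S, P.IsPrime)
    (hhom : ∀ P ∈ S, P.IsHomogeneous 𝒜) (hirr : ∀ P ∈ S, ¬ 𝒜₊.toIdeal ≤ P) :
    ∃ i, 0 < i ∧ ∃ x ∈ 𝒜 i, ∀ P ∈ S, x ∉ P := by
  classical
  have hz (P : S) : ∃ i, 0 < i ∧ ∃ x ∈ 𝒜 i, (∀ Q ∈ S.erase P.1, x ∈ Q) ∧ x ∉ P.1 :=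
    have := hprime P P.2
    exists_homogeneous_pos_mem_forall_mem_notMem (hirr P P.2)
      (fun Q hQ => hhom Q (Finset.mem_of_mem_erase hQ))
      fun Q hQ => hS (Finset.mem_of_mem_erase hQ) P.2 (Finset.ne_of_mem_erase hQ)
  choose e he z hze hzQ hzP using hz
  set E := ∏ P : S, e P
  have heE (P : S) : e P ∣ E := Finset.dvd_prod_of_mem e (Finset.mem_univ P)
  have hE : 0 < E := Finset.prod_pos fun P _ => he P
  refine ⟨E, hE, ∑ P : S, z P ^ (E / e P), sum_mem fun P _ => ?_, fun P hP hmem => ?_⟩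
  · simpa [Nat.div_mul_cancel (heE P)] using SetLike.pow_mem_graded (E / e P) (hze P)
  · rw [← Finset.add_sum_erase _ _ (Finset.mem_univ ⟨P, hP⟩), P.add_mem_iff_left] at hmem
    · exact hzP ⟨P, hP⟩ ((hprime P hP).mem_of_pow_mem _ hmem)
    · refine sum_mem fun Q hQ => P.pow_mem_of_mem (hzQ Q P (Finset.mem_erase.2 ⟨?_, hP⟩)) _
        (Nat.div_pos (Nat.le_of_dvd hE (heE Q)) (he Q))
      exact fun h => Finset.ne_of_mem_erase hQ (Subtype.ext h.symm)

theorem isHomogeneous_span_range {κ : Type*} {f : κ → A} {d : κ → ℕ} (hf : ∀ i, f i ∈ 𝒜 (d i)) :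
    (Ideal.span (Set.range f)).IsHomogeneous 𝒜 :=
  Ideal.homogeneous_span 𝒜 _ (Set.forall_mem_range.2 fun i => ⟨d i, hf i⟩)

theorem exists_homogeneous_eq_sum_of_mem_span_range {κ : Type*} [Fintype κ] {f : κ → A}
    {d : κ → ℕ} (hf : ∀ i, f i ∈ 𝒜 (d i)) {n : ℕ} {x : A} (hx : x ∈ 𝒜 n)
    (hxf : x ∈ Ideal.span (Set.range f)) :
    ∃ r : κ → A, (∀ i, r i = 0 ∨ ∃ m, d i + m = n ∧ r i ∈ 𝒜 m) ∧ x = ∑ i, f i * r i := by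
  classical
  obtain ⟨c, rfl⟩ := (Submodule.mem_span_range_iff_exists_fun A).1 hxf
  refine ⟨fun i => if d i ≤ n then decompose 𝒜 (c i) (n - d i) else 0, fun i => ?_, ?_⟩
  · by_cases hi : d i ≤ n
    · exact .inr ⟨n - d i, Nat.add_sub_cancel' hi, by simp [if_pos hi]⟩
    · exact .inl (if_neg hi)
  · conv_lhs => rw [← decompose_of_mem_same 𝒜 hx]
    rw [decompose_sum, DFinsupp.finsetSum_apply, AddSubmonoidClass.coe_finsetSum]
    refine Finset.sum_congr rfl fun i _ => ?_
    rw [smul_eq_mul, mul_comm, coe_decompose_mul_of_left_mem 𝒜 n (hf i), mul_ite, mul_zero]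

theorem decompose_eq_zero_of_mem_irrelevant_pow {t n : ℕ} (hn : n < t) {x : A}
    (hx : x ∈ 𝒜₊.toIdeal ^ t) : (decompose 𝒜 x n : A) = 0 := by
  induction t generalizing x n with
  | zero => omega
  | succ t ih =>
  rw [pow_succ] at hx
  induction hx using Submodule.mul_induction_on' with
  | add a _ b _ ha hb => simp [decompose_add, ha, hb]
  | mem_mul_mem a ha b hb =>
  classical
  rw [decompose_mul, coe_mul_apply]
  refine Finset.sum_eq_zero fun ⟨i, j⟩ hij => ?_
  obtain rfl := (Finset.mem_filter.1 hij).2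
  rcases Nat.eq_zero_or_pos j with rfl | hj
  · rw [show (decompose 𝒜 b 0 : A) = 0 from hb, mul_zero]
  · rw [ih (show i < t by grind) ha, zero_mul]

end NatGraded

section ConnectedGraded

open DirectSum HomogeneousIdeal

variable {k R : Type*} [Field k] [CommRing R] [Algebra k R] {𝒜 : ℕ → Submodule k R}
  [GradedAlgebra 𝒜]

theorem exists_sub_algebraMap_mem_irrelevant
    (h_zero : ∀ x ∈ 𝒜 0, ∃ a : k, algebraMap k R a = x) (x : R) :
    ∃ a : k, x - algebraMap k R a ∈ 𝒜₊.toIdeal := by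
  obtain ⟨a, ha⟩ := h_zero _ (decompose 𝒜 x 0).2
  refine ⟨a, ?_⟩
  rw [HomogeneousIdeal.mem_iff, mem_irrelevant_iff, map_sub, GradedRing.proj_apply,
    GradedRing.proj_apply, ha, decompose_of_mem_same 𝒜 (decompose 𝒜 x 0).2, sub_self]

theorem le_irrelevant_of_isHomogeneous (h_zero : ∀ x ∈ 𝒜 0, ∃ a : k, algebraMap k R a = x)
    {J : Ideal R} (hJ : J.IsHomogeneous 𝒜) (hJt : J ≠ ⊤) : J ≤ 𝒜₊.toIdeal := by
  intro x hx
  obtain ⟨a, ha⟩ := h_zero _ (decompose 𝒜 x 0).2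
  have haJ : algebraMap k R a ∈ J := ha ▸ hJ 0 hx
  obtain rfl | ha0 := eq_or_ne a 0
  · rw [HomogeneousIdeal.mem_iff, mem_irrelevant_iff, GradedRing.proj_apply, ← ha, map_zero]
  · exact absurd (J.eq_top_of_isUnit_mem haJ ((IsUnit.mk0 a ha0).map _)) hJt

theorem irrelevant_isMaximal [Nontrivial R]
    (h_zero : ∀ x ∈ 𝒜 0, ∃ a : k, algebraMap k R a = x) : 𝒜₊.toIdeal.IsMaximal := by
  have hne : 𝒜₊.toIdeal ≠ ⊤ := by
    rw [Ideal.ne_top_iff_one, HomogeneousIdeal.mem_iff, mem_irrelevant_iff, GradedRing.proj_apply,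
      decompose_of_mem_same 𝒜 SetLike.GradedOne.one_mem]
    exact one_ne_zero
  refine Ideal.isMaximal_iff.2 ⟨(Ideal.ne_top_iff_one _).1 hne, fun J x hJ hx hxJ => ?_⟩
  obtain ⟨a, ha⟩ := exists_sub_algebraMap_mem_irrelevant h_zero x
  have ha0 : a ≠ 0 := by
    rintro rfl
    exact hx (by rwa [map_zero, sub_zero] at ha)
  have haJ : algebraMap k R a ∈ J := (Submodule.sub_mem_iff_right J hxJ).1 (hJ ha)
  exact (Ideal.eq_top_iff_one J).1 (J.eq_top_of_isUnit_mem haJ ((IsUnit.mk0 a ha0).map _))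

theorem isIntegral_quotient_of_irrelevant_le_radical
    (h_zero : ∀ x ∈ 𝒜 0, ∃ a : k, algebraMap k R a = x) {J : Ideal R}
    (hJ : 𝒜₊.toIdeal ≤ J.radical) : Algebra.IsIntegral k (R ⧸ J) := by
  refine ⟨fun x => ?_⟩
  obtain ⟨x, rfl⟩ := Ideal.Quotient.mk_surjective x
  obtain ⟨a, ha⟩ := exists_sub_algebraMap_mem_irrelevant h_zero x
  obtain ⟨t, ht⟩ := hJ ha
  have hnil : IsIntegral k (Ideal.Quotient.mk J (x - algebraMap k R a)) := by
    refine IsIntegral.of_pow t.succ_pos ?_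
    rw [pow_succ, ← map_pow, Ideal.Quotient.eq_zero_iff_mem.2 ht, zero_mul]
    exact isIntegral_zero
  have hint := hnil.add (isIntegral_algebraMap (R := k) (A := R ⧸ J) (x := a))
  rwa [map_sub, Ideal.Quotient.mk_algebraMap, sub_add_cancel] at hint

theorem exists_homogeneous_finset_forall_sub_mem (𝒜 : ℕ → Submodule k R) [GradedAlgebra 𝒜]
    (J : Ideal R) [Module.Finite k (R ⧸ J)] :
    ∃ U : Finset R, (∀ u ∈ U, SetLike.IsHomogeneousElem 𝒜 u) ∧
      ∀ x, ∃ u ∈ Submodule.span k (U : Set R), x - u ∈ J := by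
  classical
  set π := (Ideal.Quotient.mkₐ k J).toLinearMap
  have hπ : Function.Surjective π := Ideal.Quotient.mk_surjective
  have hspan : Submodule.span k (π '' {x | SetLike.IsHomogeneousElem 𝒜 x}) = ⊤ := by
    rw [← Submodule.map_span, _root_.eq_top_iff, ← LinearMap.range_eq_top.2 hπ,
      LinearMap.range_eq_map]
    refine Submodule.map_mono fun x _ => ?_
    rw [← sum_support_decompose 𝒜 x]
    exact sum_mem fun i _ => Submodule.subset_span ⟨i, SetLike.coe_mem _⟩
  obtain ⟨V, hV, hVspan⟩ := (Submodule.fg_span_iff_fg_span_finset_subset _).1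
    (hspan ▸ Module.Finite.fg_top)
  obtain ⟨U, hU, rfl⟩ := Finset.subset_set_image_iff.1 hV
  refine ⟨U, hU, fun x => ?_⟩
  have hx : π x ∈ Submodule.span k (π '' U) := by
    rw [← Finset.coe_image, ← hVspan, hspan]
    trivial
  rw [← Submodule.map_span] at hx
  obtain ⟨u, hu, hux⟩ := hx
  exact ⟨u, hu, Ideal.Quotient.eq.1 hux.symm⟩

theorem decompose_mem_span_inter {U : Set R} (hU : ∀ u ∈ U, SetLike.IsHomogeneousElem 𝒜 u) {x : R}
    (hx : x ∈ Submodule.span k U) (n : ℕ) :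
    (decompose 𝒜 x n : R) ∈ Submodule.span k (U ∩ 𝒜 n) := by
  suffices Submodule.span k U ≤ (Submodule.span k (U ∩ 𝒜 n)).comap (GradedAlgebra.proj 𝒜 n) from
    this hx
  refine Submodule.span_le.2 fun u hu => ?_
  rw [SetLike.mem_coe, Submodule.mem_comap, GradedAlgebra.proj_apply]
  obtain ⟨i, hi⟩ := hU u hu
  obtain rfl | hin := eq_or_ne i n
  · rw [decompose_of_mem_same 𝒜 hi]
    exact Submodule.subset_span ⟨hu, hi⟩
  · rw [decompose_of_mem_ne 𝒜 hi hin]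
    exact zero_mem _

theorem exists_finset_forall_exists_mem_span_inter [Algebra.FiniteType k R]
    (h_zero : ∀ x ∈ 𝒜 0, ∃ a : k, algebraMap k R a = x) {J : Ideal R} (hJh : J.IsHomogeneous 𝒜)
    (hJ : 𝒜₊.toIdeal ≤ J.radical) :
    ∃ U : Finset R, ∀ n, ∀ x ∈ 𝒜 n, ∃ u ∈ Submodule.span k (U ∩ 𝒜 n : Set R), x - u ∈ J := by
  have := isIntegral_quotient_of_irrelevant_le_radical h_zero hJ
  have : Module.Finite k (R ⧸ J) := Algebra.IsIntegral.finite
  obtain ⟨U, hUhom, hU⟩ := exists_homogeneous_finset_forall_sub_mem 𝒜 J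
  refine ⟨U, fun n x hx => ?_⟩
  obtain ⟨u, hu, hxu⟩ := hU x
  refine ⟨decompose 𝒜 u n, decompose_mem_span_inter hUhom hu n, ?_⟩
  have := hJh n hxu
  rwa [decompose_sub, DirectSum.sub_apply, AddSubgroupClass.coe_sub,
    decompose_of_mem_same 𝒜 hx] at this

theorem exists_forall_mem_of_irrelevant_le_radical [Algebra.FiniteType k R]
    (h_zero : ∀ x ∈ 𝒜 0, ∃ a : k, algebraMap k R a = x) {J : Ideal R} (hJh : J.IsHomogeneous 𝒜)
    (hJ : 𝒜₊.toIdeal ≤ J.radical) : ∃ n₀, ∀ n, n₀ ≤ n → ∀ x ∈ 𝒜 n, x ∈ J := by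
  classical
  obtain ⟨U, hU⟩ := exists_finset_forall_exists_mem_span_inter h_zero hJh hJ
  refine ⟨U.sup (fun u => (decompose 𝒜 u).support.sup id) + 1, fun n hn x hx => ?_⟩
  obtain ⟨u, hu, hxu⟩ := hU n x hx
  have hzero : (U ∩ 𝒜 n : Set R) ⊆ {0} := by
    rintro v ⟨hvU, hvn⟩
    rw [Set.mem_singleton_iff, ← decompose_of_mem_same 𝒜 hvn]
    by_contra hv
    have hnv : n ∈ (decompose 𝒜 v).support := DFinsupp.mem_support_iff.2 fun h => hv (by simp [h])
    have := (Finset.le_sup (f := id) hnv).trans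
      (Finset.le_sup (f := fun u => (decompose 𝒜 u).support.sup id) hvU)
    simp only [id_eq] at this
    omega
  obtain rfl : u = 0 := by simpa using Submodule.span_mono hzero hu
  rwa [sub_zero] at hxu

theorem exists_forall_mem_span_range_pow [Algebra.FiniteType k R]
    (h_zero : ∀ x ∈ 𝒜 0, ∃ a : k, algebraMap k R a = x) {κ : Type*} [Finite κ] {f : κ → R}
    {d : κ → ℕ} {w : ℕ} (hdw : ∀ i, d i ≤ w) (hf : ∀ i, f i ∈ 𝒜 (d i))
    (hJ : 𝒜₊.toIdeal ≤ (Ideal.span (Set.range f)).radical) :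
    ∃ n₀ : ℕ, ∀ j n, n₀ + j * w ≤ n → ∀ x ∈ 𝒜 n, x ∈ Ideal.span (Set.range f) ^ j := by
  cases nonempty_fintype κ
  obtain ⟨n₀, hn₀⟩ :=
    exists_forall_mem_of_irrelevant_le_radical h_zero (isHomogeneous_span_range hf) hJ
  refine ⟨n₀, fun j => ?_⟩
  induction j with
  | zero => simp
  | succ j ih =>
  intro n hn x hx
  rw [add_one_mul] at hn
  obtain ⟨r, hr, rfl⟩ :=
    exists_homogeneous_eq_sum_of_mem_span_range hf hx (hn₀ n (by omega) x hx)
  rw [pow_succ']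
  refine sum_mem fun i _ => Ideal.mul_mem_mul (Ideal.subset_span ⟨i, rfl⟩) ?_
  obtain hi | ⟨m, hm, hi⟩ := hr i
  · exact hi ▸ zero_mem _
  · exact ih m (by have := hdw i; omega) _ hi

theorem finite_of_irrelevant_le_radical [Algebra.FiniteType k R]
    (h_zero : ∀ x ∈ 𝒜 0, ∃ a : k, algebraMap k R a = x) {κ : Type*} [Finite κ] {f : κ → R}
    {d : κ → ℕ} (hd : ∀ i, 0 < d i) (hf : ∀ i, f i ∈ 𝒜 (d i))
    (hJ : 𝒜₊.toIdeal ≤ (Ideal.span (Set.range f)).radical)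
    {A : Type*} [CommRing A] [Algebra k A] (φ : A →ₐ[k] R) (hφ : ∀ i, f i ∈ φ.range) :
    φ.Finite := by
  classical
  cases nonempty_fintype κ
  obtain ⟨U, hU⟩ :=
    exists_finset_forall_exists_mem_span_inter h_zero (isHomogeneous_span_range hf) hJ
  algebraize [φ.toRingHom]
  have : IsScalarTower k A R := IsScalarTower.of_algHom φ
  have hspan : ∀ n, ∀ x ∈ 𝒜 n, x ∈ Submodule.span A (U : Set R) := by
    intro n
    induction n using Nat.strong_induction_on with
    | _ n ih =>
    intro x hx
    obtain ⟨u, hu, hxu⟩ := hU n x hx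
    have hun : u ∈ 𝒜 n := Submodule.span_le.2 Set.inter_subset_right hu
    have huU : u ∈ Submodule.span A (U : Set R) :=
      Submodule.span_le_restrictScalars k A _ (Submodule.span_mono Set.inter_subset_left hu)
    obtain ⟨r, hr, hxr⟩ := exists_homogeneous_eq_sum_of_mem_span_range hf (sub_mem hx hun) hxu
    rw [← sub_add_cancel x u, hxr]
    refine add_mem (sum_mem fun i _ => ?_) huU
    obtain ⟨a, ha⟩ := hφ i
    have haf : f i * r i = a • r i := by
      rw [← ha]
      exact (Algebra.smul_def a (r i)).symm
    rw [haf]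
    refine Submodule.smul_mem _ a ?_
    obtain hi | ⟨m, hm, hi⟩ := hr i
    · exact hi ▸ zero_mem _
    · exact ih m (by have := hd i; omega) _ hi
  refine ⟨⟨U, _root_.eq_top_iff.2 fun x _ => ?_⟩⟩
  rw [← sum_support_decompose 𝒜 x]
  exact sum_mem fun i _ => hspan i _ (SetLike.coe_mem _)

end ConnectedGraded

section Powers

variable {R ι : Type*} [CommRing R]

theorem sup_span_singleton_pow_le (s : Finset ι) (g : ι → R) (q : ℕ) :
    (s.sup fun i => Ideal.span {g i}) ^ (s.card * q + 1) ≤ s.sup fun i => Ideal.span {g i ^ q} := by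
  classical
  induction s using Finset.induction_on with
  | empty => simp
  | insert i s hi ih =>
    rw [Finset.sup_insert, Finset.sup_insert, Finset.card_insert_of_notMem hi,
      show (s.card + 1) * q + 1 = q + (s.card * q + 1) by ring, ← Ideal.span_singleton_pow]
    exact Ideal.sup_pow_add_le_pow_sup_pow.trans (sup_le_sup le_rfl ih)

theorem span_range_pow_card_mul_add_one_le [Fintype ι] (g : ι → R) (q : ℕ) :
    Ideal.span (Set.range g) ^ (Fintype.card ι * q + 1) ≤
      Ideal.span (Set.range fun i => g i ^ q) := by
  have h := sup_span_singleton_pow_le Finset.univ g q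
  rwa [Finset.sup_univ_eq_iSup, Finset.sup_univ_eq_iSup, ← Ideal.span_range_eq_iSup,
    ← Ideal.span_range_eq_iSup] at h

theorem span_range_pow_le_span_range_pow (g : ι → R) (q : ℕ) :
    Ideal.span (Set.range fun i => g i ^ q) ≤ Ideal.span (Set.range g) ^ q := by
  rw [Ideal.span_le]
  rintro _ ⟨i, rfl⟩
  exact Ideal.pow_mem_pow (Ideal.subset_span (Set.mem_range_self i)) q

theorem span_range_option_elim (g : ι → R) (y : R) :
    Ideal.span (Set.range fun o : Option ι => o.elim y g) =
      Ideal.span (Set.range g) ⊔ Ideal.span {y} := by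
  rw [Ideal.span_range_eq_iSup, iSup_option, Ideal.span_range_eq_iSup, sup_comm]
  rfl

end Powers

section Torsion

open Polynomial in
theorem exists_forall_mem_span_range_pow_of_finite {k R ι : Type*} [CommRing k] [IsNoetherianRing k]
    [CommRing R] [Algebra k R] [Fintype ι] {f : ι → R} {y : R}
    (hfin : (aevalTower (MvPolynomial.aeval (R := k) f) y).Finite) :
    ∃ k₀ : ℕ, ∀ q N, ∀ x ∈ (Ideal.span (Set.range f) ⊔ Ideal.span {y}) ^
        (k₀ + Fintype.card ι * q + q),
      y ^ N * x ∈ Ideal.span (Set.range fun i => f i ^ q) *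
        (Ideal.span (Set.range f) ⊔ Ideal.span {y}) ^ (k₀ + Fintype.card ι * q + N) →
      x ∈ Ideal.span (Set.range fun i => f i ^ q) := by
  set φ := (aevalTower (MvPolynomial.aeval (R := k) f) y).toRingHom
  have hφX : φ X = y := aevalTower_X _ _
  have hφC : φ.comp C = (MvPolynomial.aeval (R := k) f).toRingHom :=
    RingHom.ext fun b => aevalTower_C _ _ b
  have hmap : ∀ q, (Ideal.span (Set.range fun i => (MvPolynomial.X i : MvPolynomial ι k) ^ q)).map
      (φ.comp C) = Ideal.span (Set.range fun i => f i ^ q) := by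
    intro q
    rw [hφC, Ideal.map_span, ← Set.range_comp]
    congr 2
    ext i
    simp
  have h𝔫 : Ideal.span (Set.range f) ⊔ Ideal.span {y} =
      (Ideal.span (Set.range (MvPolynomial.X : ι → MvPolynomial ι k))).map (φ.comp C) ⊔
        Ideal.span {φ X} := by
    have := hmap 1
    simp only [pow_one] at this
    rw [hφX, this]
  obtain ⟨k₀, hk₀⟩ := exists_forall_mem_map_of_X_pow_mul_mem hfin h𝔫
  refine ⟨k₀ + 1, fun q N x hx hyx => ?_⟩
  have h := hk₀ _ q (Fintype.card ι * q + 1) N (span_range_pow_le_span_range_pow _ q)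
    (span_range_pow_card_mul_add_one_le _ q) x
  rw [hmap, hφX] at h
  have hexp : k₀ + (Fintype.card ι * q + 1) = k₀ + 1 + Fintype.card ι * q := by ring
  rw [hexp] at h
  exact h hx hyx

open DirectSum HomogeneousIdeal

variable {k R : Type*} [Field k] [CommRing R] [Algebra k R] {𝒜 : ℕ → Submodule k R}
  [GradedAlgebra 𝒜]

open Polynomial in
theorem aevalTower_aeval_finite_of_irrelevant_le_radical [Algebra.FiniteType k R]
    (h_zero : ∀ x ∈ 𝒜 0, ∃ a : k, algebraMap k R a = x) {ι : Type*} [Finite ι] {f : ι → R}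
    {d : ι → ℕ} {y : R} {w : ℕ} (hd : ∀ i, 0 < d i) (hf : ∀ i, f i ∈ 𝒜 (d i)) (hw : 0 < w)
    (hy : y ∈ 𝒜 w)
    (hJ : 𝒜₊.toIdeal ≤ (Ideal.span (Set.range f) ⊔ Ideal.span {y}).radical) :
    (aevalTower (MvPolynomial.aeval (R := k) f) y).Finite := by
  rw [← span_range_option_elim] at hJ
  refine finite_of_irrelevant_le_radical h_zero (d := fun o : Option ι => o.elim w d)
    (by rintro (_ | i); exacts [hw, hd i]) (by rintro (_ | i); exacts [hy, hf i]) hJ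
    (aevalTower (MvPolynomial.aeval f) y) ?_
  rintro (_ | i)
  · exact ⟨X, aevalTower_X _ _⟩
  · exact ⟨C (MvPolynomial.X i), (aevalTower_C _ _ _).trans (MvPolynomial.aeval_X f i)⟩

theorem exists_forall_mem_span_range_pow_of_pow_mul_mem [Algebra.FiniteType k R]
    (h_zero : ∀ x ∈ 𝒜 0, ∃ a : k, algebraMap k R a = x) {ι : Type*} [Finite ι] {f : ι → R}
    {d : ι → ℕ} {y : R} {w : ℕ} (hd : ∀ i, 0 < d i) (hdw : ∀ i, d i ≤ w)
    (hf : ∀ i, f i ∈ 𝒜 (d i)) (hw : 0 < w) (hy : y ∈ 𝒜 w)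
    (hJ : 𝒜₊.toIdeal ≤ (Ideal.span (Set.range f) ⊔ Ideal.span {y}).radical) :
    ∃ c : ℕ, ∀ q N D x, q ≠ 0 → c * q ≤ D → x ∈ 𝒜 D →
      y ^ N * x ∈ Ideal.span (Set.range fun i => f i ^ q) →
      x ∈ Ideal.span (Set.range fun i => f i ^ q) := by
  cases nonempty_fintype ι
  obtain ⟨k₀, hk₀⟩ := exists_forall_mem_span_range_pow_of_finite
    (aevalTower_aeval_finite_of_irrelevant_le_radical h_zero hd hf hw hy hJ)
  obtain ⟨n₀, hn₀⟩ := exists_forall_mem_span_range_pow h_zero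
    (f := fun o : Option ι => o.elim y f) (d := fun o => o.elim w d) (w := w)
    (by rintro (_ | i); exacts [le_rfl, hdw i]) (by rintro (_ | i); exacts [hy, hf i])
    (by rwa [span_range_option_elim])
  rw [span_range_option_elim] at hn₀
  refine ⟨n₀ + (k₀ + Fintype.card ι + 1) * w, fun q N D x hq hD hx hyx => ?_⟩
  have hD' : n₀ + (k₀ + Fintype.card ι * q + q) * w ≤ D := by
    have hk₀q : k₀ ≤ k₀ * q := Nat.le_mul_of_pos_right k₀ (Nat.pos_of_ne_zero hq)
    have hn₀q : n₀ ≤ n₀ * q := Nat.le_mul_of_pos_right n₀ (Nat.pos_of_ne_zero hq)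
    calc n₀ + (k₀ + Fintype.card ι * q + q) * w
        ≤ n₀ * q + (k₀ * q + Fintype.card ι * q + q) * w := by gcongr
      _ = (n₀ + (k₀ + Fintype.card ι + 1) * w) * q := by ring
      _ ≤ D := hD
  refine hk₀ q N x (hn₀ _ D hD' x hx) ?_
  obtain ⟨r, hr, hrx⟩ := exists_homogeneous_eq_sum_of_mem_span_range
    (fun i => SetLike.pow_mem_graded q (hf i))
    (SetLike.mul_mem_graded (SetLike.pow_mem_graded N hy) hx) hyx
  rw [hrx]
  refine sum_mem fun i _ => Ideal.mul_mem_mul (Ideal.subset_span ⟨i, rfl⟩) ?_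
  obtain hi | ⟨m, hm, hi⟩ := hr i
  · exact hi ▸ zero_mem _
  · refine hn₀ _ m ?_ _ hi
    have hdq : q * d i ≤ q * w := Nat.mul_le_mul_left q (hdw i)
    simp only [smul_eq_mul] at hm
    linarith

end Torsion

section DimensionOne

variable {R : Type*} [CommRing R] {I : Ideal R}

theorem ringKrullDim_quotient_le_one_iff : ringKrullDim (R ⧸ I) ≤ 1 ↔
    ∀ Q : Ideal R, Q.IsPrime → I ≤ Q → Q ∈ I.minimalPrimes ∨ Q.IsMaximal := by
  rw [ringKrullDim_quotient, Order.krullDim_le_one_iff]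
  have hmin : ∀ Q : PrimeSpectrum.zeroLocus (I : Set R),
      IsMin Q ↔ Q.1.asIdeal ∈ I.minimalPrimes := fun Q =>
    ⟨fun h => ⟨⟨Q.1.2, Q.2⟩, fun P hP hPQ => @h ⟨⟨P, hP.1⟩, hP.2⟩ hPQ⟩,
      fun h P hPQ => h.2 ⟨P.1.2, P.2⟩ hPQ⟩
  have hmax : ∀ Q : PrimeSpectrum.zeroLocus (I : Set R), IsMax Q ↔ Q.1.asIdeal.IsMaximal := fun Q =>
    Iff.trans ⟨fun h P hQP => @h ⟨P, Set.Subset.trans Q.2 hQP⟩ hQP, fun h P hQP => @h P.1 hQP⟩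
      PrimeSpectrum.isMax_iff
  simp only [hmin, hmax]
  exact ⟨fun h Q hQ hIQ => h ⟨⟨Q, hQ⟩, hIQ⟩, fun h Q => h _ Q.1.2 Q.2⟩

theorem ringKrullDim_quotient_le_one_of_height_add_one_eq [IsNoetherianRing R]
    (h : (I.height : WithBot ℕ∞) + 1 = ringKrullDim R) : ringKrullDim (R ⧸ I) ≤ 1 := by
  refine ringKrullDim_quotient_le_one_iff.2 fun Q hQ hIQ => ?_
  by_contra! hcon
  obtain ⟨P, hP, hPQ⟩ := Ideal.exists_minimalPrimes_le hIQ
  have := hP.1.1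
  obtain ⟨M, hM, hQM⟩ := Ideal.exists_le_maximal Q hQ.ne_top
  have hPQ' : P < Q := hPQ.lt_of_ne fun h => hcon.1 (h ▸ hP)
  have hQM' : Q < M := hQM.lt_of_ne fun h => hcon.2 (h ▸ hM)
  have hdim : (M.height : WithBot ℕ∞) ≤ ringKrullDim R := Ideal.height_le_ringKrullDim_of_isPrime
  have hlt : I.height < P.height + 1 := by
    rw [ENat.lt_add_one_iff (Ideal.height_ne_top_of_isPrime)]
    exact Ideal.height_mono hP.1.2
  have hle : P.height + 1 + 1 ≤ I.height + 1 :=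
    calc P.height + 1 + 1 ≤ Q.height + 1 := by
          gcongr
          exact Ideal.height_add_one_le_of_lt_of_isPrime hPQ'
      _ ≤ M.height := Ideal.height_add_one_le_of_lt_of_isPrime hQM'
      _ ≤ I.height + 1 := by rw [← h] at hdim; exact_mod_cast hdim
  exact hlt.not_ge (by simpa using hle)

end DimensionOne

section PrimaryComponents

variable {R : Type*} [CommRing R]

theorem exists_pow_le_of_isPrimary_of_mem_minimalPrimes [IsNoetherianRing R] {ι : Type*}
    [Finite ι] (f : ι → R) {P : Ideal R} (hP : P ∈ (Ideal.span (Set.range f)).minimalPrimes) :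
    ∃ c : ℕ, ∀ q ≠ 0, ∀ Q : Ideal R, Q.IsPrimary → Q.radical = P →
      Ideal.span (Set.range fun i => f i ^ q) ≤ Q → P ^ (c * q) ≤ Q := by
  cases nonempty_fintype ι
  have hPp := hP.1.1
  let loc := algebraMap R (Localization.AtPrime P)
  obtain ⟨c, hc⟩ : ∃ c, P.map loc ^ c ≤ (Ideal.span (Set.range f)).map loc := by
    rw [← IsLocalization.AtPrime.radical_map_of_mem_minimalPrimes _ P _ hP]
    exact Ideal.exists_radical_pow_le_of_fg _ (IsNoetherian.noetherian _)
  refine ⟨c * (Fintype.card ι + 1), fun q hq Q hQ hQP hfQ => ?_⟩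
  have hexp : c * (Fintype.card ι * q + 1) ≤ c * (Fintype.card ι + 1) * q := by
    rw [mul_assoc, add_one_mul]
    gcongr
    exact Nat.one_le_iff_ne_zero.2 hq
  have hmap : (P ^ (c * (Fintype.card ι + 1) * q)).map loc ≤ Q.map loc :=
    calc (P ^ (c * (Fintype.card ι + 1) * q)).map loc
        ≤ (P.map loc ^ c) ^ (Fintype.card ι * q + 1) := by
          rw [Ideal.map_pow, ← pow_mul]
          exact Ideal.pow_le_pow_right hexp
      _ ≤ (Ideal.span (Set.range f) ^ (Fintype.card ι * q + 1)).map loc := by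
          rw [Ideal.map_pow]
          gcongr
      _ ≤ Q.map loc := Ideal.map_mono ((span_range_pow_card_mul_add_one_le f q).trans hfQ)
  have hdisj : Disjoint (P.primeCompl : Set R) Q :=
    Set.disjoint_left.2 fun x hxP hxQ => hxP (hQP ▸ Ideal.le_radical hxQ)
  rw [← IsLocalization.under_map_of_isPrimary_disjoint P.primeCompl (Localization.AtPrime P) hQ
    hdisj]
  exact Ideal.map_le_iff_le_comap.1 hmap

theorem exists_radical_pow_le_of_radical_mem_minimalPrimes [IsNoetherianRing R] {ι : Type*}
    [Finite ι] (f : ι → R) :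
    ∃ c : ℕ, ∀ q ≠ 0, ∀ Q : Ideal R, Q.IsPrimary →
      Q.radical ∈ (Ideal.span (Set.range f)).minimalPrimes →
      Ideal.span (Set.range fun i => f i ^ q) ≤ Q → Q.radical ^ (c * q) ≤ Q := by
  have := (Ideal.span (Set.range f)).finite_minimalPrimes_of_isNoetherianRing.to_subtype
  choose c hc using fun P : (Ideal.span (Set.range f)).minimalPrimes =>
    exists_pow_le_of_isPrimary_of_mem_minimalPrimes f P.2
  obtain ⟨b, hb⟩ := (Set.finite_range c).bddAbove
  refine ⟨b, fun q hq Q hQ hQmin hfQ => ?_⟩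
  exact (Ideal.pow_le_pow_right (Nat.mul_le_mul_right q (hb ⟨⟨_, hQmin⟩, rfl⟩))).trans
    (hc ⟨_, hQmin⟩ q hq Q hQ rfl hfQ)

theorem exists_pow_mul_mem_finset_inf {t : Finset (Ideal R)} {x y : R}
    (h : ∀ Q ∈ t, y ∈ Q.radical ∨ x ∈ Q) : ∃ N, y ^ N * x ∈ t.inf id := by
  classical
  induction t using Finset.induction_on with
  | empty => exact ⟨0, trivial⟩
  | insert Q t _ ih =>
    obtain ⟨N, hN⟩ := ih fun Q' hQ' => h Q' (Finset.mem_insert_of_mem hQ')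
    rw [Finset.inf_insert, id]
    obtain ⟨m, hm⟩ | hx := h Q (Finset.mem_insert_self Q t)
    · refine ⟨m + N, ?_, ?_⟩
      · rw [pow_add, mul_assoc]
        exact Q.mul_mem_right _ hm
      · rw [pow_add, mul_assoc]
        exact Ideal.mul_mem_left _ _ hN
    · exact ⟨N, Q.mul_mem_left _ hx, hN⟩

theorem radical_sup_pow_eq {J M : Ideal R} [hM : M.IsPrime] (hJM : J ≤ M) {n : ℕ} (hn : n ≠ 0) :
    (J ⊔ M ^ n).radical = M :=
  le_antisymm (hM.radical_le_iff.2 (sup_le hJM (Ideal.pow_le_self hn)))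
    fun _ hz => ⟨n, Ideal.mem_sup_right (Ideal.pow_mem_pow hz n)⟩

theorem exists_isPrimary_finset_inf_eq_of_isMaximal [IsNoetherianRing R] {J M : Ideal R}
    [hM : M.IsMaximal] (hJM : J ≤ M) {n : ℕ} (hn : n ≠ 0) {y : R} (hy : y ∈ M)
    (hpow : ∀ Q : Ideal R, Q.IsPrimary → J ≤ Q → Q.radical ∈ J.associatedPrimes →
      Q.radical ≠ M → Q.radical ^ n ≤ Q)
    (htors : ∀ N x, x ∈ J ⊔ M ^ n → y ^ N * x ∈ J → x ∈ J) :
    ∃ t : Finset (Ideal R), (∀ Q ∈ t, Q.IsPrimary ∧ Q.radical ^ n ≤ Q) ∧ t.inf id = J := by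
  classical
  obtain ⟨t, ht⟩ := Submodule.IsLasker.exists_isMinimalPrimaryDecomposition
    (Submodule.isLasker R R) J
  have hJt : ∀ Q ∈ t, J ≤ Q := fun Q hQ => ht.inf_eq ▸ Finset.inf_le (f := id) hQ
  have hrad := radical_sup_pow_eq hJM hn
  refine ⟨insert (J ⊔ M ^ n) (t.filter fun Q => Q.radical ≠ M), ?_, le_antisymm ?_ ?_⟩
  · simp only [Finset.forall_mem_insert, Finset.mem_filter]
    refine ⟨⟨Ideal.isPrimary_of_isMaximal_radical (by rwa [hrad]), hrad.symm ▸ le_sup_right⟩, ?_⟩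
    rintro Q ⟨hQ, hQM⟩
    have hass := ht.mem_associatedPrimes hQ
    rw [Submodule.colon_univ] at hass
    exact ⟨ht.primary hQ, hpow Q (ht.primary hQ) (hJt Q hQ) hass hQM⟩
  · intro x hx
    rw [Finset.inf_insert, id] at hx
    obtain ⟨N, hN⟩ : ∃ N, y ^ N * x ∈ t.inf id := by
      refine exists_pow_mul_mem_finset_inf fun Q hQ => ?_
      by_cases hQM : Q.radical = M
      · exact .inl (hQM ▸ hy)
      · exact .inr (Finset.inf_le (f := id) (Finset.mem_filter.2 ⟨hQ, hQM⟩) hx.2)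
    exact htors N x hx.1 (ht.inf_eq ▸ hN)
  · rw [Finset.inf_insert]
    exact le_inf le_sup_left (Finset.le_inf fun Q hQ => hJt Q (Finset.mem_filter.1 hQ).1)

end PrimaryComponents

section Parameter

open DirectSum HomogeneousIdeal

variable {k R : Type*} [Field k] [CommRing R] [Algebra k R] {𝒜 : ℕ → Submodule k R}
  [GradedAlgebra 𝒜]

theorem mem_minimalPrimes_or_eq_irrelevant (h_zero : ∀ x ∈ 𝒜 0, ∃ a : k, algebraMap k R a = x)
    {I : Ideal R} (hdim : ringKrullDim (R ⧸ I) ≤ 1) {Q : Ideal R} (hQ : Q.IsPrime)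
    (hQhom : Q.IsHomogeneous 𝒜) (hIQ : I ≤ Q) : Q ∈ I.minimalPrimes ∨ Q = 𝒜₊.toIdeal := by
  have : Nontrivial R := not_subsingleton_iff_nontrivial.1 fun _ =>
    hQ.ne_top (Subsingleton.elim _ _)
  refine (ringKrullDim_quotient_le_one_iff.1 hdim Q hQ hIQ).imp_right fun hmax => ?_
  exact hmax.eq_of_le (irrelevant_isMaximal h_zero).ne_top
    (le_irrelevant_of_isHomogeneous h_zero hQhom hQ.ne_top)

theorem exists_homogeneous_pos_irrelevant_le_radical_sup [IsNoetherianRing R]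
    (h_zero : ∀ x ∈ 𝒜 0, ∃ a : k, algebraMap k R a = x) {I : Ideal R} (hI : I.IsHomogeneous 𝒜)
    (hdim : ringKrullDim (R ⧸ I) ≤ 1) :
    ∃ w, 0 < w ∧ ∃ y ∈ 𝒜 w, 𝒜₊.toIdeal ≤ (I ⊔ Ideal.span {y}).radical := by
  classical
  have hfin := I.finite_minimalPrimes_of_isNoetherianRing
  set S := hfin.toFinset.filter fun P => ¬ 𝒜₊.toIdeal ≤ P
  have hS : ∀ P, P ∈ S ↔ P ∈ I.minimalPrimes ∧ ¬ 𝒜₊.toIdeal ≤ P := fun P => by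
    rw [Finset.mem_filter, hfin.mem_toFinset]
  have hanti : IsAntichain (· ≤ ·) (S : Set (Ideal R)) := fun P hP P' hP' hne hle =>
    hne (hle.antisymm (((hS P').1 hP').1.2 ((hS P).1 hP).1.1 hle))
  obtain ⟨w, hw, y, hy, hyS⟩ := exists_homogeneous_pos_forall_notMem (𝒜 := 𝒜) hanti
    (fun P hP => ((hS P).1 hP).1.1.1)
    (fun P hP => isHomogeneous_of_mem_minimalPrimes hI ((hS P).1 hP).1)
    (fun P hP => ((hS P).1 hP).2)
  refine ⟨w, hw, y, hy, ?_⟩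
  rw [← Ideal.sInf_minimalPrimes]
  refine le_sInf fun Q hQ => ?_
  have hsup : (I ⊔ Ideal.span {y}).IsHomogeneous 𝒜 :=
    hI.sup (Ideal.homogeneous_span 𝒜 _ fun x hx => ⟨w, hx ▸ hy⟩)
  have hyQ : y ∈ Q := hQ.1.2 (Ideal.mem_sup_right (Ideal.mem_span_singleton_self y))
  obtain hmin | rfl := mem_minimalPrimes_or_eq_irrelevant h_zero hdim hQ.1.1
    (isHomogeneous_of_mem_minimalPrimes hsup hQ) (le_sup_left.trans hQ.1.2)
  · by_contra hirr
    exact hyS Q ((hS Q).2 ⟨hmin, hirr⟩) hyQ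
  · exact le_rfl

theorem exists_homogeneous_ge_irrelevant_le_radical_sup [IsNoetherianRing R]
    (h_zero : ∀ x ∈ 𝒜 0, ∃ a : k, algebraMap k R a = x) {I : Ideal R} (hI : I.IsHomogeneous 𝒜)
    (hdim : ringKrullDim (R ⧸ I) ≤ 1) (b : ℕ) :
    ∃ w, 0 < w ∧ b ≤ w ∧ ∃ y ∈ 𝒜 w, 𝒜₊.toIdeal ≤ (I ⊔ Ideal.span {y}).radical := by
  obtain ⟨w, hw, y, hy, hle⟩ := exists_homogeneous_pos_irrelevant_le_radical_sup h_zero hI hdim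
  have hbw : b ≤ (b + 1) • w := by
    rw [smul_eq_mul]
    exact b.le_succ.trans (Nat.le_mul_of_pos_right _ hw)
  refine ⟨(b + 1) • w, by positivity, hbw, y ^ (b + 1), SetLike.pow_mem_graded _ hy, hle.trans
    (Ideal.radical_le_radical_iff.2 (sup_le (le_sup_left.trans Ideal.le_radical) ?_))⟩
  rw [Ideal.span_singleton_le_iff_mem]
  exact ⟨b + 1, Ideal.mem_sup_right (Ideal.mem_span_singleton_self _)⟩

theorem exists_finset_homogeneous_pos_span_eq
    (h_zero : ∀ x ∈ 𝒜 0, ∃ a : k, algebraMap k R a = x) {I : Ideal R} (hI : I.IsHomogeneous 𝒜)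
    (hIt : I ≠ ⊤) (hfg : I.FG) :
    ∃ s : Finset R, (∀ x ∈ s, ∃ d, 0 < d ∧ x ∈ 𝒜 d) ∧ Ideal.span (s : Set R) = I := by
  have hcore : Ideal.span (Subtype.val '' {x : SetLike.homogeneousSubmonoid 𝒜 | x.1 ∈ I}) = I :=
    hI.toIdeal_homogeneousCore_eq_self
  obtain ⟨s, hs, hspan⟩ := (Submodule.fg_span_iff_fg_span_finset_subset _).1 (hcore ▸ hfg)
  refine ⟨s, fun x hx => ?_, hspan.symm.trans hcore⟩
  obtain ⟨⟨x, d, hd⟩, hxI, rfl⟩ := hs hx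
  obtain rfl | hd₀ := Nat.eq_zero_or_pos d
  · have hx₀ := le_irrelevant_of_isHomogeneous h_zero hI hIt hxI
    rw [HomogeneousIdeal.mem_iff, mem_irrelevant_iff, GradedRing.proj_apply,
      decompose_of_mem_same 𝒜 hd] at hx₀
    exact ⟨1, one_pos, by simpa only [hx₀] using zero_mem (𝒜 1)⟩
  · exact ⟨d, hd₀, hd⟩

end Parameter

section GradedDecomposition

open DirectSum HomogeneousIdeal

variable {k R : Type*} [Field k] [CommRing R] [Algebra k R] {𝒜 : ℕ → Submodule k R}
  [GradedAlgebra 𝒜]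

theorem mem_of_pow_mul_mem_of_mem_sup_irrelevant_pow {J : Ideal R} (hJ : J.IsHomogeneous 𝒜)
    {w n N : ℕ} {x y : R} (hy : y ∈ 𝒜 w)
    (htors : ∀ D z, n ≤ D → z ∈ 𝒜 D → y ^ N * z ∈ J → z ∈ J)
    (hx : x ∈ J ⊔ 𝒜₊.toIdeal ^ n) (hyx : y ^ N * x ∈ J) : x ∈ J := by
  obtain ⟨u, hu, z, hz, rfl⟩ := Submodule.mem_sup.1 hx
  refine add_mem hu ((hJ.mem_iff).2 fun i => ?_)
  obtain hi | hi := lt_or_ge i n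
  · rw [decompose_eq_zero_of_mem_irrelevant_pow hi hz]
    exact zero_mem J
  · have hyz : y ^ N * z ∈ J := by
      rwa [mul_add, Ideal.add_mem_iff_right _ (J.mul_mem_left _ hu)] at hyx
    have hcomp := hJ (N • w + i) hyz
    rw [coe_decompose_mul_add_of_left_mem 𝒜 (SetLike.pow_mem_graded N hy)] at hcomp
    exact htors i _ hi (SetLike.coe_mem _) hcomp

theorem mem_minimalPrimes_of_mem_associatedPrimes_span_range_pow [IsNoetherianRing R]
    (h_zero : ∀ x ∈ 𝒜 0, ∃ a : k, algebraMap k R a = x) {ι : Type*} {f : ι → R}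
    (hdim : ringKrullDim (R ⧸ Ideal.span (Set.range f)) ≤ 1) {q : ℕ}
    (hJ : (Ideal.span (Set.range fun i => f i ^ q)).IsHomogeneous 𝒜) {P : Ideal R}
    (hP : P ∈ (Ideal.span (Set.range fun i => f i ^ q)).associatedPrimes)
    (hPM : P ≠ 𝒜₊.toIdeal) :
    P ∈ (Ideal.span (Set.range f)).minimalPrimes := by
  have hPp : P.IsPrime := hP.1
  obtain ⟨_, x, hx⟩ := id hP
  have hJP : Ideal.span (Set.range fun i => f i ^ q) ≤ P :=
    hx ▸ Ideal.le_colon.trans Ideal.le_radical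
  refine (mem_minimalPrimes_or_eq_irrelevant h_zero hdim hPp
    (isHomogeneous_of_mem_associatedPrimes hJ hP) ?_).resolve_right hPM
  rw [Ideal.span_le]
  rintro _ ⟨i, rfl⟩
  exact hPp.mem_of_pow_mem q (hJP (Ideal.subset_span ⟨i, rfl⟩))

theorem exists_forall_isPrimary_finset_inf_eq_span_range_pow [Nontrivial R] [Algebra.FiniteType k R]
    (h_zero : ∀ x ∈ 𝒜 0, ∃ a : k, algebraMap k R a = x) {ι : Type*} [Finite ι] {f : ι → R}
    {d : ι → ℕ} (hd : ∀ i, 0 < d i) (hf : ∀ i, f i ∈ 𝒜 (d i))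
    (hdim : ringKrullDim (R ⧸ Ideal.span (Set.range f)) ≤ 1) :
    ∃ c : ℕ, ∀ q ≠ 0, ∃ t : Finset (Ideal R),
      (∀ Q ∈ t, Q.IsPrimary ∧ Q.radical ^ (c * q) ≤ Q) ∧
      t.inf id = Ideal.span (Set.range fun i => f i ^ q) := by
  have : IsNoetherianRing R := Algebra.FiniteType.isNoetherianRing k R
  have := irrelevant_isMaximal (𝒜 := 𝒜) h_zero
  obtain ⟨b, hb⟩ := (Set.finite_range d).bddAbove
  obtain ⟨w, hw, hbw, y, hy, hyrad⟩ := exists_homogeneous_ge_irrelevant_le_radical_sup h_zero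
    (isHomogeneous_span_range hf) hdim b
  obtain ⟨c₁, hc₁⟩ := exists_radical_pow_le_of_radical_mem_minimalPrimes f
  obtain ⟨c₂, hc₂⟩ := exists_forall_mem_span_range_pow_of_pow_mul_mem h_zero hd
    (fun i => (hb ⟨i, rfl⟩).trans hbw) hf hw hy hyrad
  refine ⟨c₁ + c₂ + 1, fun q hq => ?_⟩
  have hJ : (Ideal.span (Set.range fun i => f i ^ q)).IsHomogeneous 𝒜 :=
    isHomogeneous_span_range fun i => SetLike.pow_mem_graded q (hf i)
  have hJM : Ideal.span (Set.range fun i => f i ^ q) ≤ 𝒜₊.toIdeal := by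
    rw [Ideal.span_le]
    rintro _ ⟨i, rfl⟩
    exact Ideal.pow_mem_of_mem _ (mem_irrelevant_of_mem 𝒜 (hd i) (hf i)) q (Nat.pos_of_ne_zero hq)
  refine exists_isPrimary_finset_inf_eq_of_isMaximal hJM (by positivity)
    (mem_irrelevant_of_mem 𝒜 hw hy) (fun Q hQ hJQ hass hQM => ?_) fun N x => ?_
  · have hmin := mem_minimalPrimes_of_mem_associatedPrimes_span_range_pow h_zero hdim hJ
      hass hQM
    exact (Ideal.pow_le_pow_right (Nat.mul_le_mul_right q (by omega))).trans
      (hc₁ q hq Q hQ hmin hJQ)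
  · exact mem_of_pow_mul_mem_of_mem_sup_irrelevant_pow hJ hy fun D z hD =>
      hc₂ q N D z hq ((Nat.mul_le_mul_right q (by omega)).trans hD)

end GradedDecomposition

section FrobeniusPowers

variable {R : Type*} [CommRing R]

theorem frobeniusPower_le_pow (I : Ideal R) (n : ℕ) : frobeniusPower I n ≤ I ^ n := by
  rw [frobeniusPower, Ideal.span_le]
  rintro _ ⟨x, hx, rfl⟩
  exact Ideal.pow_mem_pow hx n

theorem frobeniusPower_top (n : ℕ) : frobeniusPower (⊤ : Ideal R) n = ⊤ :=
  (Ideal.eq_top_iff_one _).2 (Ideal.subset_span ⟨1, trivial, one_pow n⟩)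

theorem hasLinearGrowthOfPrimaryDecompositions_of_forall_finset {p : ℕ} {I : Ideal R} (c : ℕ)
    (h : ∀ e, ∃ t : Finset (Ideal R), (∀ Q ∈ t, Q.IsPrimary ∧ Q.radical ^ (c * p ^ e) ≤ Q) ∧
      t.inf id = frobeniusPower I (p ^ e)) :
    HasLinearGrowthOfPrimaryDecompositions p I := by
  refine ⟨c, fun e => ?_⟩
  obtain ⟨t, ht, hinf⟩ := h e
  refine ⟨t.card, fun i => t.equivFin.symm i, fun i => (ht _ (Subtype.prop _)).1, ?_, fun i => ?_⟩
  · rw [← hinf, t.equivFin.symm.iInf_comp (g := fun Q : t => Q.1), Finset.inf_eq_iInf, iInf_subtype]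
    rfl
  · refine (frobeniusPower_le_pow _ _).trans ?_
    rw [← pow_mul]
    exact (ht _ (Subtype.prop _)).2

end FrobeniusPowers

theorem mainTheorem4_general {k R : Type*} [Field k] (p : ℕ) (hp : p.Prime) [CharP k p]
    [CommRing R] [Algebra k R] [Algebra.FiniteType k R]
    (𝒜 : ℕ → Submodule k R) [GradedAlgebra 𝒜]
    (h_zero : ∀ x ∈ 𝒜 0, ∃ a : k, algebraMap k R a = x)
    (I : Ideal R) (hI : I.IsHomogeneous 𝒜) (hdim : ringKrullDim (R ⧸ I) ≤ 1) :
    HasLinearGrowthOfPrimaryDecompositions p I := by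
  by_cases hIt : I = ⊤
  · refine hasLinearGrowthOfPrimaryDecompositions_of_forall_finset 0 fun e => ⟨∅, by simp, ?_⟩
    rw [hIt, frobeniusPower_top, Finset.inf_empty]
  have : Fact p.Prime := ⟨hp⟩
  have : Nontrivial R := not_subsingleton_iff_nontrivial.1 fun _ => hIt (Subsingleton.elim _ _)
  have : CharP R p := charP_of_injective_algebraMap (algebraMap k R).injective p
  have : IsNoetherianRing R := Algebra.FiniteType.isNoetherianRing k R
  obtain ⟨s, hs, rfl⟩ := exists_finset_homogeneous_pos_span_eq h_zero hI hIt
    (IsNoetherian.noetherian I)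
  choose d hd hsd using fun x : s => hs x x.2
  have hrange : (s : Set R) = Set.range ((↑) : s → R) := Subtype.range_coe.symm
  rw [hrange] at hdim ⊢
  obtain ⟨c, hc⟩ := exists_forall_isPrimary_finset_inf_eq_span_range_pow h_zero hd hsd hdim
  refine hasLinearGrowthOfPrimaryDecompositions_of_forall_finset c fun e => ?_
  rw [frobeniusPower_span, ← Set.range_comp]
  exact hc (p ^ e) (pow_ne_zero e hp.ne_zero)

/-- `R` is a finitely generated algebra over the field `k`, positively graded: it is `ℕ`-graded
and its degree-zero component is `k`. The generators may have any positive degrees. -/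
theorem mainTheorem4 {k R : Type*} [Field k] (p : ℕ) (hp : p.Prime) [CharP k p]
    [CommRing R] [Algebra k R] [Algebra.FiniteType k R]
    (𝒜 : ℕ → Submodule k R) [GradedAlgebra 𝒜]
    (h_zero : ∀ x ∈ 𝒜 0, ∃ a : k, algebraMap k R a = x)
    (I : Ideal R) (hI : I.IsHomogeneous 𝒜)
    (h_height : (I.height : WithBot ℕ∞) + 1 = ringKrullDim R) :
    HasLinearGrowthOfPrimaryDecompositions p I :=
  have := Algebra.FiniteType.isNoetherianRing k R
  mainTheorem4_general p hp 𝒜 h_zero I hI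
    (ringKrullDim_quotient_le_one_of_height_add_one_eq h_height)
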